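/- Let $G=(V,E)$ be a finite, simple, undirected, connected graph with at least two vertices that is (claw, $P_6$)-free, i.e. no induced subgraph of $G$ is isomorphic to the claw $K_{1,3}$ or to the chordless path $P_6$ on six vertices. A set $S\subseteq V$ is dominating if every vertex of $G$ is in $S$ or adjacent to an element of $S$; $\gamma(G)$ denotes the minimum cardinality of a dominating set of $G$, and $\mathrm{core}(G)$ denotes the set of vertices that belong to every dominating set of cardinality $\gamma(G)$. For $v\in V$ let $G-v$ be the subgraph of $G$ induced by $V\setminus\{v\}$, and let $V^0=\{v\in V:\gamma(G-v)=\gamma(G)\}$. Then for every $v\in V$, $$v\in\mathrm{core}(G)\iff\gamma(G-v)>\gamma(G).$$ In particular, $\mathrm{core}(G)\cap V^0=\emptyset$. -/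

import Mathlib

namespace SimpleGraph

universe u

/-- `S` is a dominating set of `G`: every vertex is in `S` or adjacent to an element of `S`. -/
def IsDominatingSet {V : Type u} (G : SimpleGraph V) (S : Finset V) : Prop :=
  ∀ v : V, v ∈ S ∨ ∃ w ∈ S, G.Adj v w

/-- The domination number `γ(G)` of a finite graph: the minimum cardinality of a dominating set. -/
noncomputable def dominationNumber {V : Type u} (G : SimpleGraph V) : ℕ :=
  sInf {k : ℕ | ∃ S : Finset V, G.IsDominatingSet S ∧ S.card = k}

/-- `S` is a minimum dominating set (a `γ`-set) of `G`. -/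
def IsMinDominatingSet {V : Type u} (G : SimpleGraph V) (S : Finset V) : Prop :=
  G.IsDominatingSet S ∧ S.card = G.dominationNumber

/-- The set of the vertices that belong to all minimum dominating sets of `G`. -/
def dominationCore {V : Type u} (G : SimpleGraph V) : Set V :=
  {v : V | ∀ S : Finset V, G.IsMinDominatingSet S → v ∈ S}

/-- The graph `G - v`: the subgraph of `G` induced by the vertices other than `v`. -/
def minusVertex {V : Type u} (G : SimpleGraph V) (v : V) :
    SimpleGraph ({v}ᶜ : Set V) :=
  G.induce ({v}ᶜ : Set V)

/-- The set `V⁰` of the vertices whose deletion does not change the domination number. -/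
def dominationStableVertices {V : Type u} (G : SimpleGraph V) : Set V :=
  {v : V | (G.minusVertex v).dominationNumber = G.dominationNumber}

/-- The claw `K_{1,3}`. -/
def claw : SimpleGraph (Fin 1 ⊕ Fin 3) := completeBipartiteGraph (Fin 1) (Fin 3)

/-- `G` is `H`-free: no induced subgraph of `G` is isomorphic to `H`. -/
def IsInducedFree {W : Type*} {V : Type u} (H : SimpleGraph W) (G : SimpleGraph V) : Prop :=
  ¬ H.IsIndContained G

end SimpleGraph

/-! A minimum dominating set avoiding `v` also dominates `G - v`; this gives one direction. For the
other, let `v` lie in the core with γ(G-v) ≤ γ(G). Claw-freeness makes minimum dominating sets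
independent: take such an `S` for `G` and such a `D` for `G - v`; `D` misses N[v]. Since `v` cannot
be exchanged for a neighbour, it has nonadjacent private neighbours `a`, `b`. Their `D`-neighbours
`a'`, `b'` share, by `P₆`-freeness, a single `S`-neighbour `s`, which closes an induced hexagon. The
exchanges of {v, s} for {a, b'} and for {b, a'} must fail; the failures yield common neighbours `r`,
`q` of `v` and `s`, and {r, q} does replace {v, s}: a contradiction. -/

namespace SimpleGraph

variable {V : Type*} {G : SimpleGraph V}

/-! ### Forbidden induced subgraphs -/

/-- In a claw-free graph, three distinct neighbours of a vertex are never pairwise nonadjacent. -/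
theorem IsInducedFree.adj_of_claw (h : IsInducedFree claw G) {c x y z : V}
    (hx : G.Adj c x) (hy : G.Adj c y) (hz : G.Adj c z) (hxy : x ≠ y) (hxz : x ≠ z)
    (hyz : y ≠ z) : G.Adj x y ∨ G.Adj x z ∨ G.Adj y z := by
  by_contra! hn
  obtain ⟨h1, h2, h3⟩ := hn
  have key : ∀ i j : Fin 1 ⊕ Fin 3, G.Adj (Sum.elim (fun _ => c) ![x, y, z] i)
      (Sum.elim (fun _ => c) ![x, y, z] j) ↔ claw.Adj i j := by
    rintro (i | i) (j | j)
    · simp [claw]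
    · fin_cases j <;> simp [claw, hx, hy, hz]
    · fin_cases i <;> simp [claw, hx.symm, hy.symm, hz.symm]
    · fin_cases i <;> fin_cases j <;> simp [claw, h1, h2, h3, G.adj_comm y x, G.adj_comm z x,
        G.adj_comm z y]
  refine h ⟨⟨⟨Sum.elim (fun _ => c) ![x, y, z], ?_⟩, fun {i j} => key i j⟩⟩
  rintro (i | i) (j | j) hij
  · simp [Subsingleton.elim i j]
  · fin_cases j <;> simp_all
  · fin_cases i <;> simp_all
  · fin_cases i <;> fin_cases j <;> simp_all

/-- In a `P₆`-free graph, a walk on six vertices has a chord. -/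
theorem IsInducedFree.false_of_path_six (h : IsInducedFree (pathGraph 6) G)
    {a b c d e f : V} (hab : G.Adj a b) (hbc : G.Adj b c) (hcd : G.Adj c d) (hde : G.Adj d e)
    (hef : G.Adj e f) (hac : ¬ G.Adj a c) (had : ¬ G.Adj a d) (hae : ¬ G.Adj a e)
    (haf : ¬ G.Adj a f) (hbd : ¬ G.Adj b d) (hbe : ¬ G.Adj b e) (hbf : ¬ G.Adj b f)
    (hce : ¬ G.Adj c e) (hcf : ¬ G.Adj c f) (hdf : ¬ G.Adj d f) : False := by
  have key : ∀ i j : Fin 6,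
      G.Adj (![a, b, c, d, e, f] i) (![a, b, c, d, e, f] j) ↔ (pathGraph 6).Adj i j := by
    intro i j
    rw [pathGraph_adj]
    fin_cases i <;> fin_cases j <;> simp [hab, hbc, hcd, hde, hef, hac, had, hae, haf, hbd, hbe,
      hbf, hce, hcf, hdf, hab.symm, hbc.symm, hcd.symm, hde.symm, hef.symm, G.adj_comm c a,
      G.adj_comm d a, G.adj_comm e a, G.adj_comm f a, G.adj_comm d b, G.adj_comm e b,
      G.adj_comm f b, G.adj_comm e c, G.adj_comm f c, G.adj_comm f d]
  -- Distinct vertices of `P₆` have distinct neighbourhoods, so injectivity follows from `key`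
  -- alone.
  have sep : ∀ i j : Fin 6, i ≠ j → ∃ k : Fin 6,
      ¬ ((i.val + 1 = k.val ∨ k.val + 1 = i.val) ↔ (j.val + 1 = k.val ∨ k.val + 1 = j.val)) := by
    decide
  refine h ⟨⟨⟨![a, b, c, d, e, f], fun i j hij => ?_⟩, fun {i j} => key i j⟩⟩
  by_contra hne
  obtain ⟨k, hk⟩ := sep i j hne
  rw [← pathGraph_adj, ← pathGraph_adj, ← key, ← key, hij] at hk
  exact hk Iff.rfl

/-! ### Domination number and independent dominating sets -/

/-- In a claw-free graph, a set `D ⊆ W` dominating `W` may be replaced by an independent one which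
is not larger. -/
theorem exists_isIndepSet_dominating_of_clawFree (hC : IsInducedFree claw G) {W D : Finset V}
    (hDW : D ⊆ W) (hD : ∀ u ∈ W, u ∈ D ∨ ∃ w ∈ D, G.Adj u w) :
    ∃ T ⊆ W, G.IsIndepSet (T : Set V) ∧ (∀ u ∈ W, u ∈ T ∨ ∃ w ∈ T, G.Adj u w) ∧
      T.card ≤ D.card := by
  classical
  have ext : ∀ (U J : Finset V), J ⊆ U → G.IsIndepSet (J : Set V) →
      ∃ T, J ⊆ T ∧ T ⊆ U ∧ G.IsIndepSet (T : Set V) ∧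
        ∀ u ∈ U, u ∈ T ∨ ∃ w ∈ T, G.Adj u w := by
    intro U J hJU hJ
    obtain ⟨T, hJT, hT⟩ := (U.powerset.filter
      (fun T : Finset V => G.IsIndepSet (T : Set V))).exists_le_maximal
      (Finset.mem_filter.2 ⟨Finset.mem_powerset.2 hJU, hJ⟩)
    have hTm := Finset.mem_filter.1 hT.1
    have hTU := Finset.mem_powerset.1 hTm.1
    refine ⟨T, hJT, hTU, hTm.2, fun u hu => ?_⟩
    by_contra! hn
    refine hn.1 (hT.2 (y := insert u T) (Finset.mem_filter.2
      ⟨Finset.mem_powerset.2 (Finset.insert_subset hu hTU), ?_⟩)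
      (Finset.subset_insert u T) (Finset.mem_insert_self u T))
    rw [Finset.coe_insert]
    refine Set.Pairwise.insert hTm.2 fun w hw _ => ⟨hn.2 w hw, fun h => hn.2 w hw h.symm⟩
  obtain ⟨I, -, hID, hI, hIdom⟩ := ext D ∅ (Finset.empty_subset _) (by simp [IsIndepSet])
  obtain ⟨T, hIT, hTW, hT, hTdom⟩ := ext W I (hID.trans hDW) hI
  refine ⟨T, hTW, hT, hTdom, ?_⟩
  -- Sending `x` to such a `d` is injective: two preimages and an `I`-neighbour of `d` would form a
  -- claw at `d`.
  have hex : ∀ x ∈ T \ I, ∃ d ∈ D \ I, G.Adj x d := by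
    intro x hx
    obtain ⟨hxT, hxI⟩ := Finset.mem_sdiff.1 hx
    have hno : ∀ w ∈ T, ¬ G.Adj x w := fun w hw h => hT hxT hw h.ne h
    have hxD : x ∉ D := fun hxD => by
      rcases hIdom x hxD with h | ⟨w, hw, h⟩
      · exact hxI h
      · exact hno w (hIT hw) h
    obtain ⟨d, hd, hxd⟩ := (hD x (hTW hxT)).resolve_left hxD
    exact ⟨d, Finset.mem_sdiff.2 ⟨hd, fun hdI => hno d (hIT hdI) hxd⟩, hxd⟩
  choose! f hf hadj using hex
  have hle : (T \ I).card ≤ (D \ I).card := by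
    refine Finset.card_le_card_of_injOn f hf fun x hx y hy hxy => ?_
    by_contra hne
    have hxa := hadj x hx
    have hya := hadj y hy
    obtain ⟨hdD, hdI⟩ := Finset.mem_sdiff.1 (hf x hx)
    obtain ⟨hxT, hxI⟩ := Finset.mem_sdiff.1 hx
    obtain ⟨hyT, hyI⟩ := Finset.mem_sdiff.1 hy
    obtain ⟨i, hi, hdi⟩ := (hIdom _ hdD).resolve_left hdI
    have hix : i ≠ x := fun h => hxI (h ▸ hi)
    have hiy : i ≠ y := fun h => hyI (h ▸ hi)
    rw [← hxy] at hya
    rcases hC.adj_of_claw hdi hxa.symm hya.symm hix hiy hne with h | h | h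
    · exact hT (hIT hi) hxT hix h
    · exact hT (hIT hi) hyT hiy h
    · exact hT hxT hyT hne h
  have h1 := Finset.card_sdiff_add_card_eq_card hIT
  have h2 := Finset.card_sdiff_add_card_eq_card hID
  omega

theorem dominationNumber_le_card {S : Finset V} (hS : G.IsDominatingSet S) :
    G.dominationNumber ≤ S.card :=
  Nat.sInf_le ⟨S, hS, rfl⟩

theorem exists_isMinDominatingSet [Finite V] (G : SimpleGraph V) :
    ∃ S, G.IsMinDominatingSet S := by
  have := Fintype.ofFinite V
  exact Nat.sInf_mem (s := {k | ∃ S : Finset V, G.IsDominatingSet S ∧ S.card = k})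
    ⟨_, Finset.univ, fun v => Or.inl (Finset.mem_univ v), rfl⟩

/-- A vertex whose deletion increases the domination number lies in every minimum dominating
set. -/
theorem mem_dominationCore_of_lt {v : V}
    (h : G.dominationNumber < (G.minusVertex v).dominationNumber) : v ∈ G.dominationCore := by
  classical
  intro S hS
  by_contra hv
  refine absurd h (not_lt.2 ?_)
  have hsub : ∀ x ∈ S, x ∈ ({v}ᶜ : Set V) := fun x hx hxv => hv (hxv ▸ hx)
  rw [← hS.2, ← Finset.card_attach (s := S),
    ← Finset.card_image_of_injective S.attach (f := fun x => (⟨x.1, hsub x.1 x.2⟩ : ({v}ᶜ : Set V)))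
      (fun x y hxy => Subtype.ext (congrArg (fun z : ({v}ᶜ : Set V) => z.1) hxy))]
  refine dominationNumber_le_card fun u => ?_
  rcases hS.1 u.1 with hu | ⟨w, hw, huw⟩
  · exact Or.inl (Finset.mem_image.2 ⟨⟨u.1, hu⟩, Finset.mem_attach _ _, rfl⟩)
  · exact Or.inr ⟨⟨w, hsub w hw⟩, Finset.mem_image.2 ⟨⟨w, hw⟩, Finset.mem_attach _ _, rfl⟩, huw⟩

/-- A minimum dominating set of `G - v`, seen in `G`. -/
theorem exists_dominating_compl_singleton [Finite V] (G : SimpleGraph V) (v : V) :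
    ∃ D : Finset V, v ∉ D ∧ (∀ u, u ≠ v → u ∈ D ∨ ∃ w ∈ D, G.Adj u w) ∧
      D.card = (G.minusVertex v).dominationNumber := by
  obtain ⟨D, hD, hcard⟩ := (G.minusVertex v).exists_isMinDominatingSet
  refine ⟨D.map (Function.Embedding.subtype _), ?_, fun u hu => ?_, by simpa using hcard⟩
  · simp
  · rcases hD ⟨u, hu⟩ with h | ⟨w, hw, h⟩
    · exact Or.inl (Finset.mem_map.2 ⟨_, h, rfl⟩)
    · exact Or.inr ⟨w, Finset.mem_map.2 ⟨_, hw, rfl⟩, h⟩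

/-! ### Exchange arguments around a hexagon -/

/-- Let `v`, `s` belong to an independent dominating set `S`, and let `v, a, a', s, b', b` be an
induced hexagon in a (claw, `P₆`)-free graph such that all private neighbours of `v` are dominated
by `a` and `b'`. If `a` and `b'` cannot replace `v` and `s` in `S`, then some common neighbour
of `v` and `s` is adjacent to `a'` and `b`, but not to `a` or `b'`. -/
theorem exists_common_neighbor_of_not_dominating [DecidableEq V] (hC : IsInducedFree claw G)
    (hP : IsInducedFree (pathGraph 6) G) {S : Finset V} (hS : G.IsDominatingSet S)
    {v s a a' b b' : V} (hva : G.Adj v a) (haa : G.Adj a a') (hsa : G.Adj s a')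
    (hvb : G.Adj v b) (hbb : G.Adj b b') (hsb : G.Adj s b')
    (hab : ¬ G.Adj a b) (hne : a ≠ b) (hab' : ¬ G.Adj a b')
    (hne' : a' ≠ b') (hab'' : ¬ G.Adj a' b') (hvs : ¬ G.Adj v s)
    (hvb' : ¬ G.Adj v b') (hsa' : ¬ G.Adj s a) (hsb' : ¬ G.Adj s b)
    (hpriv : ∀ p, G.Adj v p → (∀ w ∈ S, G.Adj p w → w = v) →
      p = a ∨ G.Adj p a ∨ G.Adj p b')
    (hnd : ¬ G.IsDominatingSet (insert a (insert b' ((S.erase v).erase s)))) :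
    ∃ r, G.Adj v r ∧ G.Adj s r ∧ G.Adj r a' ∧ G.Adj r b ∧ ¬ G.Adj r a ∧ ¬ G.Adj r b' := by
  simp only [IsDominatingSet, not_forall, not_or, not_exists, not_and, Finset.mem_insert,
    Finset.mem_erase] at hnd
  obtain ⟨u, ⟨hua, hub', hu⟩, hdom⟩ := hnd
  have hua' : ¬ G.Adj u a := hdom a (Or.inl rfl)
  have hub : ¬ G.Adj u b' := hdom b' (Or.inr (Or.inl rfl))
  have huv : u ≠ v := by rintro rfl; exact hua' hva
  have hus : u ≠ s := by rintro rfl; exact hub hsb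
  have huS : u ∉ S := fun h => hu hus huv h
  have hnbr : ∀ w ∈ S, G.Adj u w → w = v ∨ w = s := by
    intro w hw h
    by_contra! hn
    exact hdom w (Or.inr (Or.inr ⟨hn.2, hn.1, hw⟩)) h
  -- Otherwise `u` is a private neighbour of `v`, already covered by `hpriv`.
  have hsu : G.Adj s u := by
    by_contra hsu
    obtain ⟨w, hw, huw⟩ := (hS u).resolve_left huS
    have hon : ∀ w ∈ S, G.Adj u w → w = v := fun w hw h =>
      (hnbr w hw h).resolve_right fun e => hsu (e ▸ h.symm)
    have := hpriv u ((hon w hw huw) ▸ huw.symm) hon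
    tauto
  have hua'' : u ≠ a' := by rintro rfl; exact hua' haa.symm
  have hadj : G.Adj u a' := by
    rcases hC.adj_of_claw hsu hsa hsb hua'' hub' hne' with h | h | h
    · exact h
    · exact absurd h hub
    · exact absurd h hab''
  have hub2 : u ≠ b := by rintro rfl; exact hsb' hsu
  have hvb2 : v ≠ b' := by rintro rfl; exact hvs hsb.symm
  -- Otherwise `u, s, b', b, v, a` is an induced `P₆`.
  have hvu : G.Adj v u := by
    by_contra hvu
    have h1 : ¬ G.Adj u b := fun h => by
      rcases hC.adj_of_claw hvb.symm hbb h.symm hvb2 huv.symm (Ne.symm hub') with h | h | h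
      · exact hvb' h
      · exact hvu h
      · exact hub h.symm
    exact hP.false_of_path_six hsu.symm hsb hbb.symm hvb.symm hva hub h1
      (fun h => hvu h.symm) hua' hsb' (fun h => hvs h.symm) hsa' (fun h => hvb' h.symm)
      (fun h => hab' h.symm) (fun h => hab h.symm)
  refine ⟨u, hvu, hsu, hadj, ?_, hua', hub⟩
  rcases hC.adj_of_claw hvu hva hvb hua hub2 hne with h | h | h
  · exact absurd h hua'
  · exact h
  · exact absurd h hab

/-- In a (claw, `P₆`)-free graph, let `S` be an independent dominating set containing `v`. If an
independent set `D` without elements in the closed neighbourhood of `v` dominates all vertices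
other than `v`, then some dominating set not containing `v` is no larger than `S`. -/
theorem exists_dominating_notMem_of_clawFree_pathFree (hC : IsInducedFree claw G)
    (hP : IsInducedFree (pathGraph 6) G) {S D : Finset V} {v : V} (hS : G.IsDominatingSet S)
    (hSi : G.IsIndepSet (S : Set V)) (hvS : v ∈ S) (hDi : G.IsIndepSet (D : Set V))
    (hD : ∀ u, u ≠ v → u ∈ D ∨ ∃ w ∈ D, G.Adj u w) (hvD : v ∉ D)
    (hDv : ∀ w ∈ D, ¬ G.Adj v w) (hdeg : ∃ x, G.Adj v x) :
    ∃ T : Finset V, G.IsDominatingSet T ∧ T.card ≤ S.card ∧ v ∉ T := by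
  classical
  by_contra! hcore
  have hSn : ∀ x ∈ S, ∀ y ∈ S, ¬ G.Adj x y := fun x hx y hy h => hSi hx hy h.ne h
  have hDn : ∀ x ∈ D, ∀ y ∈ D, ¬ G.Adj x y := fun x hx y hy h => hDi hx hy h.ne h
  -- exchanging `v` for one of its neighbours leaves a private neighbour of `v` undominated
  have swap : ∀ x, G.Adj v x → ∃ p, G.Adj v p ∧ (∀ w ∈ S, G.Adj p w → w = v) ∧
      p ≠ x ∧ ¬ G.Adj p x := by
    intro x hvx
    by_contra! hn
    have hmem := hcore (insert x (S.erase v)) (fun u => ?_) (by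
      have h1 := Finset.card_insert_le x (S.erase v)
      have h2 := Finset.card_erase_add_one hvS
      omega)
    · rcases Finset.mem_insert.1 hmem with h | h
      · exact hvx.ne h
      · exact Finset.notMem_erase v S h
    · by_cases huv : u = v
      · exact Or.inr ⟨x, Finset.mem_insert_self _ _, huv ▸ hvx⟩
      by_cases huS : u ∈ S
      · exact Or.inl (Finset.mem_insert_of_mem (Finset.mem_erase.2 ⟨huv, huS⟩))
      obtain ⟨w, hw, huw⟩ := (hS u).resolve_left huS
      by_cases hall : ∀ w ∈ S, G.Adj u w → w = v
      · by_cases hux : u = x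
        · exact Or.inl (hux ▸ Finset.mem_insert_self _ _)
        · exact Or.inr ⟨x, Finset.mem_insert_self _ _,
            hn u ((hall w hw huw) ▸ huw.symm) hall hux⟩
      · push Not at hall
        obtain ⟨w, hw, huw, hwv⟩ := hall
        exact Or.inr ⟨w, Finset.mem_insert_of_mem (Finset.mem_erase.2 ⟨hwv, hw⟩), huw⟩
  -- every private neighbour `p` of `v` starts a path to an element of `D` and one of `S`
  have path : ∀ p, G.Adj v p → (∀ w ∈ S, G.Adj p w → w = v) → ∃ d ∈ D, G.Adj p d ∧
      ∃ s ∈ S, G.Adj s d ∧ s ≠ v ∧ ∀ w ∈ S, G.Adj d w → w = s := by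
    intro p hvp hp
    obtain ⟨d, hd, hpd⟩ := (hD p hvp.ne').resolve_left fun h => hDv p h hvp
    have hdv : d ≠ v := fun h => hvD (h ▸ hd)
    have hdS : d ∉ S := fun h => hdv (hp d h hpd)
    obtain ⟨s, hs, hds⟩ := (hS d).resolve_left hdS
    have hsv : ∀ w ∈ S, G.Adj d w → w ≠ v := fun w _ h e => hDv d hd (e ▸ h.symm)
    refine ⟨d, hd, hpd, s, hs, hds.symm, hsv s hs hds, fun w hw hdw => ?_⟩
    -- A second `S`-neighbour of `d` would form a claw at `d` with `p` and `s`.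
    by_contra hne
    have hpw : ∀ w ∈ S, G.Adj d w → p ≠ w := fun w hw h e => hSn v hvS w hw (e ▸ hvp)
    rcases hC.adj_of_claw hpd.symm hdw hds (hpw w hw hdw) (hpw s hs hds) hne with h | h | h
    · exact hsv w hw hdw (hp w hw h)
    · exact hsv s hs hds (hp s hs h)
    · exact hSn w hw s hs h
  obtain ⟨x, hvx⟩ := hdeg
  obtain ⟨a, hva, hpa, -, -⟩ := swap x hvx
  obtain ⟨b, hvb, hpb, hba, hnba⟩ := swap a hva
  obtain ⟨a', ha'D, haa', s, hsS, hsa', hsv, hua'⟩ := path a hva hpa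
  obtain ⟨b', hb'D, hbb', t, htS, htb', htv, hub'⟩ := path b hvb hpb
  have hnab : ¬ G.Adj a b := fun h => hnba h.symm
  have hvs : ¬ G.Adj v s := hSn v hvS s hsS
  have hva' := hDv a' ha'D
  have hvb' := hDv b' hb'D
  have hna'b' := hDn a' ha'D b' hb'D
  have hnp : ∀ p, G.Adj v p → (∀ w ∈ S, G.Adj p w → w = v) → ∀ w ∈ S, w ≠ v →
      ¬ G.Adj w p ∧ p ≠ w := fun p hvp hp w hw hwv =>
    ⟨fun h => hwv (hp w hw h.symm), fun e => hSn v hvS w hw (e ▸ hvp)⟩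
  -- the private neighbours adjacent to an element of `D` form a clique
  have clique : ∀ d s, s ∈ S → s ≠ v → G.Adj s d → ∀ p q, G.Adj v p →
      (∀ w ∈ S, G.Adj p w → w = v) → G.Adj v q → (∀ w ∈ S, G.Adj q w → w = v) →
      G.Adj p d → G.Adj q d → p ≠ q → G.Adj p q := by
    intro d s hs hsv hsd p q hvp hp hvq hq hpd hqd hpq
    obtain ⟨h1, h2⟩ := hnp p hvp hp s hs hsv
    obtain ⟨h3, h4⟩ := hnp q hvq hq s hs hsv
    rcases hC.adj_of_claw hpd.symm hqd.symm hsd.symm hpq h2 h4 with h | h | h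
    · exact h
    · exact absurd h.symm h1
    · exact absurd h.symm h3
  have hba' : ¬ G.Adj b a' := fun h =>
    hnab (clique a' s hsS hsv hsa' a b hva hpa hvb hpb haa' h hba.symm)
  have hab' : ¬ G.Adj a b' := fun h =>
    hnab (clique b' t htS htv htb' a b hva hpa hvb hpb h hbb' hba.symm)
  have hne' : a' ≠ b' := fun e => hab' (e ▸ haa')
  have hsa := (hnp a hva hpa s hsS hsv).1
  have hsb := (hnp b hvb hpb s hsS hsv).1
  -- Otherwise `s, a', a, v, b, b'` is an induced `P₆`.
  have hst : t = s := by
    by_contra hne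
    have hsb' : ¬ G.Adj s b' := fun h => hne (hub' s hsS h.symm).symm
    exact hP.false_of_path_six hsa' haa'.symm hva.symm hvb hbb' hsa (fun h => hvs h.symm) hsb hsb'
      (fun h => hva' h.symm) (fun h => hba' h.symm) hna'b' hnab hab' hvb'
  subst hst
  -- a private neighbour adjacent to `c` is adjacent to one of `c'`, `e'`
  have near : ∀ c c' e' p, G.Adj v c → (∀ w ∈ S, G.Adj c w → w = v) → c' ∈ D → e' ∈ D →
      c' ≠ e' → G.Adj c c' → G.Adj t c' → (∀ w ∈ S, G.Adj c' w → w = t) → G.Adj t e' →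
      G.Adj v p → (∀ w ∈ S, G.Adj p w → w = v) → G.Adj p c → G.Adj p c' ∨ G.Adj p e' := by
    intro c c' e' p hvc hpc hc'D he'D hce hcc htc huc hte hvp hpp hpc'
    by_contra! hn
    obtain ⟨d, hdD, hpd, s, hs, hsd, hsv', hud⟩ := path p hvp hpp
    have hdc : c' ≠ d := fun e => hn.1 (e ▸ hpd)
    have hde : e' ≠ d := fun e => hn.2 (e ▸ hpd)
    have hdv : v ≠ d := fun e => hvD (e ▸ hdD)
    have hcv : v ≠ c' := fun e => hvD (e ▸ hc'D)
    -- Equality gives a claw at `t` with leaves in `D`; otherwise `t, c', c, p, d, s` is an induced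
    -- `P₆`.
    by_cases hst : s = t
    · subst hst
      rcases hC.adj_of_claw htc hte hsd hce hdc hde with h | h | h
      · exact hDn _ hc'D _ he'D h
      · exact hDn _ hc'D _ hdD h
      · exact hDn _ he'D _ hdD h
    · have hcd : ¬ G.Adj c d := fun h => by
        rcases hC.adj_of_claw hvc.symm hcc h hcv hdv hdc with h | h | h
        · exact hDv _ hc'D h
        · exact hDv _ hdD h
        · exact hDn _ hc'D _ hdD h
      exact hP.false_of_path_six htc hcc.symm hpc'.symm hpd hsd.symm
        (hnp c hvc hpc t htS htv).1 (hnp p hvp hpp t htS htv).1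
        (fun h => hst (hud t htS h.symm).symm) (hSn t htS s hs) (fun h => hn.1 h.symm)
        (hDn _ hc'D _ hdD) (fun h => hst (huc s hs h)) hcd
        (fun h => (hnp c hvc hpc s hs hsv').1 h.symm)
        (fun h => (hnp p hvp hpp s hs hsv').1 h.symm)
  have cover : ∀ p, G.Adj v p → (∀ w ∈ S, G.Adj p w → w = v) → G.Adj p a' ∨ G.Adj p b' := by
    intro p hvp hpp
    by_cases hpa' : p = a
    · exact Or.inl (hpa' ▸ haa')
    by_cases hpb' : p = b
    · exact Or.inr (hpb' ▸ hbb')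
    rcases hC.adj_of_claw hvp hva hvb hpa' hpb' hba.symm with h | h | h
    · exact near a a' b' p hva hpa ha'D hb'D hne' haa' hsa' hua' htb' hvp hpp h
    · exact (near b b' a' p hvb hpb hb'D ha'D hne'.symm hbb' htb' hub' hsa' hvp hpp h).symm
    · exact absurd h hnab
  have hnot : ∀ x y, v ≠ x → v ≠ y →
      ¬ G.IsDominatingSet (insert x (insert y ((S.erase v).erase t))) := by
    intro x y hx hy hdom
    have hmem := hcore _ hdom (by
      have h1 := Finset.card_insert_le x (insert y ((S.erase v).erase t))
      have h2 := Finset.card_insert_le y ((S.erase v).erase t)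
      have h3 := Finset.card_erase_add_one hvS
      have h4 := Finset.card_erase_add_one (Finset.mem_erase.2 ⟨htv, htS⟩)
      omega)
    simp [hx, hy] at hmem
  have hva2 : v ≠ a' := fun e => hvD (e ▸ ha'D)
  have hvb2 : v ≠ b' := fun e => hvD (e ▸ hb'D)
  obtain ⟨r, hvr, htr, hra', hrb, hra, hrb'⟩ :=
    exists_common_neighbor_of_not_dominating hC hP hS hva haa' hsa' hvb hbb' htb' hnab hba.symm
      hab' hne' hna'b' hvs hvb' hsa hsb
      (fun p hvp hpp => by
        by_cases hpa' : p = a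
        · exact Or.inl hpa'
        · exact Or.inr ((cover p hvp hpp).imp_left fun h =>
            clique a' t htS htv hsa' p a hvp hpp hva hpa h haa' hpa'))
      (hnot a b' hva.ne hvb2)
  obtain ⟨q, hvq, htq, hqb', hqa, hqb, hqa'⟩ :=
    exists_common_neighbor_of_not_dominating hC hP hS hvb hbb' htb' hva haa' hsa' hnba hba
      hba' hne'.symm (fun h => hna'b' h.symm) hvs hva' hsb hsa
      (fun p hvp hpp => by
        by_cases hpb' : p = b
        · exact Or.inl hpb'
        · exact Or.inr ((cover p hvp hpp).symm.imp_left fun h =>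
            clique b' t htS htv htb' p b hvp hpp hvb hpb h hbb' hpb'))
      (hnot b a' hvb.ne hva2)
  have hrq : r ≠ q := fun e => hqa' (e ▸ hra')
  have hnrq : ¬ G.Adj r q := fun h => by
    have h1 : a' ≠ b := fun e => hva' (e ▸ hvb)
    have h2 : a' ≠ q := fun e => hva' (e ▸ hvq)
    have h3 : b ≠ q := fun e => hsb (e ▸ htq)
    rcases hC.adj_of_claw hra' hrb h h1 h2 h3 with h | h | h
    · exact hba' h.symm
    · exact hqa' h.symm
    · exact hqb h.symm
  -- Applied to `c = v` and `c = t`: a neighbour missed by the nonadjacent `r` and `q` would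
  -- complete a claw at `c`.
  have hN : ∀ c, G.Adj c r → G.Adj c q → ∀ u, G.Adj u c →
      u = r ∨ u = q ∨ G.Adj u r ∨ G.Adj u q := by
    intro c hcr hcq u huc
    by_cases hur : u = r
    · exact Or.inl hur
    by_cases huq : u = q
    · exact Or.inr (Or.inl huq)
    have := hC.adj_of_claw huc.symm hcr hcq hur huq hrq
    tauto
  refine hnot r q hvr.ne hvq.ne fun u => ?_
  simp only [Finset.mem_insert, Finset.mem_erase]
  have fin : (u = r ∨ u = q ∨ G.Adj u r ∨ G.Adj u q) →
      (u = r ∨ u = q ∨ u ≠ t ∧ u ≠ v ∧ u ∈ S) ∨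
        ∃ w, (w = r ∨ w = q ∨ w ≠ t ∧ w ≠ v ∧ w ∈ S) ∧ G.Adj u w := by
    rintro (h | h | h | h)
    · exact Or.inl (Or.inl h)
    · exact Or.inl (Or.inr (Or.inl h))
    · exact Or.inr ⟨r, Or.inl rfl, h⟩
    · exact Or.inr ⟨q, Or.inr (Or.inl rfl), h⟩
  by_cases huv : u = v
  · exact fin (Or.inr (Or.inr (Or.inl (huv ▸ hvr))))
  by_cases hut : u = t
  · exact fin (Or.inr (Or.inr (Or.inl (hut ▸ htr))))
  by_cases huS : u ∈ S
  · exact Or.inl (Or.inr (Or.inr ⟨hut, huv, huS⟩))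
  obtain ⟨w, hw, huw⟩ := (hS u).resolve_left huS
  by_cases hwv : w = v
  · exact fin (hN v hvr hvq u (hwv ▸ huw))
  by_cases hwt : w = t
  · exact fin (hN t htr htq u (hwt ▸ huw))
  exact Or.inr ⟨w, Or.inr (Or.inr ⟨hwt, hwv, hw⟩), huw⟩

/-- In a connected (claw, `P₆`)-free graph with at least two vertices, deleting a vertex that lies
in every minimum dominating set increases the domination number. -/
theorem lt_dominationNumber_minusVertex [Finite V] [Nontrivial V] (hconn : G.Connected)
    (hC : IsInducedFree claw G) (hP : IsInducedFree (pathGraph 6) G) {v : V}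
    (hv : v ∈ G.dominationCore) :
    G.dominationNumber < (G.minusVertex v).dominationNumber := by
  classical
  have := Fintype.ofFinite V
  by_contra! hle
  have hcore : ∀ T : Finset V, G.IsDominatingSet T → T.card ≤ G.dominationNumber → v ∈ T :=
    fun T hT hc => hv T ⟨hT, le_antisymm hc (dominationNumber_le_card hT)⟩
  obtain ⟨x, hvx⟩ : ∃ x, G.Adj v x := hconn.preconnected.exists_adj_of_nontrivial v
  obtain ⟨S₀, hS₀, hS₀c⟩ := G.exists_isMinDominatingSet
  obtain ⟨S, -, hSi, hS, hSc⟩ := exists_isIndepSet_dominating_of_clawFree hC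
    (Finset.subset_univ S₀) (fun u _ => hS₀ u)
  obtain ⟨D₀, hvD₀, hD₀, hD₀c⟩ := G.exists_dominating_compl_singleton v
  obtain ⟨D, hDW, hDi, hD, hDc⟩ := exists_isIndepSet_dominating_of_clawFree hC
    (W := Finset.univ.erase v) (D := D₀)
    (fun u hu => Finset.mem_erase.2 ⟨fun e => hvD₀ (e ▸ hu), Finset.mem_univ u⟩)
    (fun u hu => hD₀ u (Finset.ne_of_mem_erase hu))
  have hvD : v ∉ D := fun h => Finset.notMem_erase v _ (hDW h)
  have hD' : ∀ u, u ≠ v → u ∈ D ∨ ∃ w ∈ D, G.Adj u w := fun u hu =>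
    hD u (Finset.mem_erase.2 ⟨hu, Finset.mem_univ u⟩)
  -- Otherwise `D` dominates `G` with at most γ(G) elements, so the core vertex `v` would lie in it.
  have hDv : ∀ w ∈ D, ¬ G.Adj v w := fun w hw h => hvD <| hcore D (fun u => by
    by_cases hu : u = v
    · exact Or.inr ⟨w, hw, hu ▸ h⟩
    · exact hD' u hu) (by omega)
  have hSdom : G.IsDominatingSet S := fun u => hS u (Finset.mem_univ u)
  obtain ⟨T, hT, hTc, hvT⟩ := exists_dominating_notMem_of_clawFree_pathFree hC hP hSdom hSi
    (hcore S hSdom (by omega)) hDi hD' hvD hDv ⟨x, hvx⟩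
  exact hvT (hcore T hT (by omega))

end SimpleGraph

theorem mainTheorem4 {V : Type*} [Finite V] [Nontrivial V] (G : SimpleGraph V)
    (hconn : G.Connected)
    (hclaw : SimpleGraph.IsInducedFree SimpleGraph.claw G)
    (hP6 : SimpleGraph.IsInducedFree (SimpleGraph.pathGraph 6) G) :
    (∀ v : V, v ∈ G.dominationCore ↔
      (G.minusVertex v).dominationNumber > G.dominationNumber) ∧
    G.dominationCore ∩ G.dominationStableVertices = ∅ := by
  refine ⟨fun v => ⟨SimpleGraph.lt_dominationNumber_minusVertex hconn hclaw hP6,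
    SimpleGraph.mem_dominationCore_of_lt⟩, Set.eq_empty_iff_forall_notMem.2 ?_⟩
  rintro v ⟨hv, hv0⟩
  exact (SimpleGraph.lt_dominationNumber_minusVertex hconn hclaw hP6 hv).ne' hv0
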